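/- Call a topology $\tau$ on a complex commutative unital algebra $A$ a Fréchet algebra topology if $(A,\tau)$ is a complete, metrizable, locally convex algebra whose topology is defined by an increasing sequence $(p_m)$ of submultiplicative seminorms ($p_m(ab)\le p_m(a)p_m(b)$). Let $k\ge 1$ be an integer, and let $\mathcal F_k=\mathbb C[[X_1,\dots,X_k]]$ be the algebra of formal power series in $k$ commuting indeterminates, with the topology of coefficientwise convergence. A Fréchet algebra of power series in $\mathcal F_k$ is a unital subalgebra $A$ of $\mathcal F_k$ that contains $X_1,\dots,X_k$, together with a Fréchet algebra topology $\tau$ on $A$ for which the inclusion $A\hookrightarrow\mathcal F_k$ is continuous. **Corollary 4.3.** Let $(A,\tau)$ be a Fréchet algebra of power series in $\mathcal F_k$. Then $A$ has a unique Fréchet algebra topology, that is, every Fréchet algebra topology on the algebra $A$ is equal to $\tau$. -/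

import Mathlib

/-- `τ` is a Fréchet algebra topology on the complex commutative unital algebra `A`: it makes `A` a
complete metrizable locally convex algebra, and it is defined by an increasing sequence of
submultiplicative seminorms (`WithSeminorms p` says that `p` generates the topology; this makes the
algebra operations continuous). Completeness refers to the uniform structure of the additive
topological group `A`. -/
structure IsFrechetAlgebraTopology (A : Type*) [CommRing A] [Algebra ℂ A]
    (τ : TopologicalSpace A) : Prop where
  isTopologicalAddGroup : IsTopologicalAddGroup A
  metrizable : TopologicalSpace.MetrizableSpace A
  complete : @CompleteSpace A (IsTopologicalAddGroup.rightUniformSpace A)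
  exists_seminorms : ∃ p : ℕ → Seminorm ℂ A, Monotone p ∧
    (∀ m x y, p m (x * y) ≤ p m x * p m y) ∧ WithSeminorms p

/-- The subalgebra `A` of `ℂ[[X₁, …, X_k]]`, with the topology `τ`, is a Fréchet algebra of power
series in `k` indeterminates: `τ` is a Fréchet algebra topology on `A`, the indeterminates belong to
`A`, and the inclusion of `A` in `ℂ[[X₁, …, X_k]]` is continuous, where `ℂ[[X₁, …, X_k]]` carries
the topology of coefficientwise convergence. -/
structure IsFrechetAlgebraOfPowerSeries {k : ℕ} (A : Subalgebra ℂ (MvPowerSeries (Fin k) ℂ))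
    (τ : TopologicalSpace A) : Prop where
  isFrechet : IsFrechetAlgebraTopology A τ
  X_mem : ∀ i : Fin k, (MvPowerSeries.X i : MvPowerSeries (Fin k) ℂ) ∈ A
  continuous_inclusion :
    @Continuous A (MvPowerSeries (Fin k) ℂ) τ
      (MvPowerSeries.WithPiTopology.instTopologicalSpace ℂ)
      (fun a => (a : MvPowerSeries (Fin k) ℂ))

/-!
Let `q` be the seminorms of `τ` and `p` those of another Fréchet algebra topology `σ` on `A`, and
let `S` be the separating ideal: the limits in `τ` of sequences that tend to `0` in `σ`. By the
closed graph theorem it suffices to show that `S = 0`.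

* *Stability* (`separatingIdeal_stability`). For `f ∈ A` and each seminorm `q m`, the `q m`-closures
  of `f ^ n * S` are eventually constant; otherwise a gliding hump produces `∑ f ^ i * a i` in `A`
  on which `q m` would be infinite. Applied to the indeterminates, this shows that in `q m` the
  ideals `W n = ∑ i, X i ^ n * S` are dense in one another for large `n`.
* *Mittag-Leffler* (`exists_mem_separatingIdeal_eq_mul`). Let `F` be an arbitrary power series and
  `s ∈ S`. The truncations of `F`, multiplied by `s`, differ by elements of `W n`. By density they
  can be corrected by elements of `W n`, which have no low order coefficients, so that they converge
  in `τ`; the limit is `F * s`. Hence `S` is an ideal of the whole ring `ℂ[[X₁, …, X_k]]`.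
* *Finite codimension* (`exists_bound_coeff_of_mem_separatingIdeal`). This ring is Noetherian, so
  `S` is finitely generated and `W n` has finite codimension in `S`. As `W n` is the range of a
  continuous operator `S ^ k → S`, the open mapping theorem shows that all functionals on `S`
  vanishing on `W n` are continuous for `σ`. The coefficient functionals on `S` are of this kind.
* *Conclusion* (`separatingIdeal_eq_bot`). If `s ∈ S` and `u n → 0` in `σ`, `u n → s` in `τ`, then
  the coefficients of `u n * s` tend to `0` by the continuity for `σ`, and to those of `s * s` by
  the continuity for `τ`. So `s * s = 0`, and `s = 0` because the power series form a domain.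

The closed graph and open mapping theorems for Fréchet spaces are both contained in
`IsFrechetSeminorms.exists_bound`. Fréchet spaces are handled throughout by increasing sequences of
seminorms, which makes it easy to have two topologies on the same space.
-/

open Filter Topology

/-! ### Fréchet spaces and the closed graph theorem -/

/-- An increasing sequence of seminorms that turns `E` into a Fréchet space: it separates points,
and every sequence that is Cauchy for all the seminorms converges. -/
structure IsFrechetSeminorms {E : Type*} [AddCommGroup E] [Module ℂ E]
    (p : ℕ → Seminorm ℂ E) : Prop where
  mono : Monotone p
  eq_zero : ∀ x, (∀ m, p m x = 0) → x = 0
  complete : ∀ u : ℕ → E,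
    (∀ m, ∀ ε : ℝ, 0 < ε → ∃ N, ∀ i, N ≤ i → ∀ j, N ≤ j → p m (u i - u j) < ε) →
    ∃ x, ∀ m, Tendsto (fun n => p m (u n - x)) atTop (𝓝 0)

section Frechet

variable {E G : Type*} [AddCommGroup E] [Module ℂ E] [AddCommGroup G] [Module ℂ G]

theorem cauchySeq_iff_seminorms [UniformSpace E] [IsUniformAddGroup E] {p : ℕ → Seminorm ℂ E}
    (hp : WithSeminorms p) (u : ℕ → E) :
    CauchySeq u ↔
      ∀ m, ∀ ε : ℝ, 0 < ε → ∃ N, ∀ i, N ≤ i → ∀ j, N ≤ j → p m (u i - u j) < ε := by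
  rw [cauchySeq_iff_tendsto, uniformity_eq_comap_nhds_zero, tendsto_comap_iff, hp.tendsto_nhds]
  refine forall_congr' fun m => forall_congr' fun ε => imp_congr_right fun hε => ?_
  rw [← prod_atTop_atTop_eq, eventually_prod_self_iff']
  simp only [sub_zero, Function.comp_apply, Prod.map_apply]
  constructor
  · rintro ⟨t, ht, h⟩
    obtain ⟨N, hN⟩ := mem_atTop_sets.1 ht
    exact ⟨N, fun i hi j hj => h j (hN j hj) i (hN i hi)⟩
  · rintro ⟨N, h⟩
    exact ⟨Set.Ici N, Ici_mem_atTop N, fun x hx y hy => h y hy x hx⟩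

theorem tendsto_iff_seminorms [TopologicalSpace E] {p : ℕ → Seminorm ℂ E}
    (hp : WithSeminorms p) (u : ℕ → E) (x : E) :
    Tendsto u atTop (𝓝 x) ↔ ∀ m, Tendsto (fun n => p m (u n - x)) atTop (𝓝 0) := by
  rw [hp.tendsto_nhds_atTop]
  refine forall_congr' fun m => ?_
  simp only [Metric.tendsto_atTop, dist_zero_right, Real.norm_of_nonneg (apply_nonneg (p m) _)]

/-- Baire's theorem: if countably many sets cover a Fréchet space, then one of them is dense in some
ball. -/
theorem IsFrechetSeminorms.baire {p : ℕ → Seminorm ℂ E} (hp : IsFrechetSeminorms p)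
    {C : ℕ → Set E} (hC : ⋃ n, C n = Set.univ) :
    ∃ n x m, ∃ δ : ℝ, 0 < δ ∧ ∀ y, p m (y - x) < δ → ∀ l, ∀ ε : ℝ, 0 < ε →
      ∃ c ∈ C n, p l (y - c) < ε := by
  let : TopologicalSpace E := (SeminormFamily.moduleFilterBasis (𝕜 := ℂ) p).topology
  have hw : WithSeminorms p := ⟨rfl⟩
  have := hw.topologicalAddGroup
  have := hw.firstCountableTopology
  let : UniformSpace E := IsTopologicalAddGroup.rightUniformSpace E
  have : IsUniformAddGroup E := isUniformAddGroup_of_addCommGroup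
  have := IsUniformAddGroup.uniformity_countably_generated (α := E)
  let : PseudoMetricSpace E := UniformSpace.pseudoMetricSpace E
  have : CompleteSpace E := by
    refine Metric.complete_of_cauchySeq_tendsto fun u hu => ?_
    obtain ⟨x, hx⟩ := hp.complete u ((cauchySeq_iff_seminorms hw u).1 hu)
    exact ⟨x, (tendsto_iff_seminorms hw u x).2 hx⟩
  obtain ⟨n, x, hx⟩ := nonempty_interior_of_iUnion_of_closed (f := fun n => closure (C n))
    (fun _ => isClosed_closure) (Set.eq_univ_of_subset (Set.iUnion_mono fun n => subset_closure) hC)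
  rw [mem_interior_iff_mem_nhds, hw.mem_nhds_iff] at hx
  obtain ⟨s, δ, hδ, hs⟩ := hx
  refine ⟨n, x, s.sup id, δ, hδ, fun y hy l ε hε => ?_⟩
  have hle : s.sup p ≤ p (s.sup id) :=
    Finset.sup_le fun i hi => hp.mono (Finset.le_sup (f := id) hi)
  have hyc : y ∈ closure (C n) := hs ((Seminorm.mem_ball _).2 ((hle _).trans_lt hy))
  obtain ⟨c, hc, hcC⟩ := mem_closure_iff_nhds.1 hyc ((p l).ball y ε)
    ((hw.mem_nhds_iff _ _).2 ⟨{l}, ε, hε, by simp⟩)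
  exact ⟨c, hcC, by rw [map_sub_rev]; exact (Seminorm.mem_ball _).1 hc⟩

theorem IsFrechetSeminorms.complete_of_geometric {p : ℕ → Seminorm ℂ E} (hp : IsFrechetSeminorms p)
    {u : ℕ → E} (hu : ∀ n, p n (u (n + 1) - u n) ≤ (1 / 2) ^ n) :
    ∃ x, ∀ m, Tendsto (fun n => p m (u n - x)) atTop (𝓝 0) := by
  refine hp.complete u fun m ε hε => ?_
  have key : ∀ i, m ≤ i → ∀ j, p m (u (i + j) - u i) ≤ 2 * (1 / 2) ^ i - 2 * (1 / 2) ^ (i + j) := by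
    intro i hi j
    induction j with
    | zero => simp
    | succ j ih =>
      have h1 := hp.mono (hi.trans (Nat.le_add_right i j)) (u (i + j + 1) - u (i + j))
      have h2 := hu (i + j)
      have h3 := map_add_le_add (p m) (u (i + j + 1) - u (i + j)) (u (i + j) - u i)
      rw [sub_add_sub_cancel] at h3
      rw [← add_assoc, pow_succ]
      linarith
  obtain ⟨N, hN⟩ := exists_pow_lt_of_lt_one (show 0 < ε / 4 by positivity)
    (show (1 / 2 : ℝ) < 1 by norm_num)
  have key' : ∀ i, max m N ≤ i → p m (u i - u (max m N)) < ε / 2 := by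
    intro i hi
    obtain ⟨j, rfl⟩ := Nat.exists_eq_add_of_le hi
    have h1 := key (max m N) (le_max_left _ _) j
    have h2 : (1 / 2 : ℝ) ^ max m N ≤ (1 / 2) ^ N :=
      pow_le_pow_of_le_one (by norm_num) (by norm_num) (le_max_right _ _)
    have h3 : (0 : ℝ) < (1 / 2) ^ (max m N + j) := by positivity
    linarith
  refine ⟨max m N, fun i hi j hj => ?_⟩
  have h1 := key' i hi
  have h2 := key' j hj
  rw [map_sub_rev] at h2
  have h3 := map_add_le_add (p m) (u i - u (max m N)) (u (max m N) - u j)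
  rw [sub_add_sub_cancel] at h3
  linarith

theorem Seminorm.map_real_smul (p : Seminorm ℂ E) {t : ℝ} (ht : 0 ≤ t) (x : E) :
    p ((t : ℂ) • x) = t * p x := by
  rw [map_smul_eq_mul, Complex.norm_real, Real.norm_of_nonneg ht]

/-- A surjective linear map onto a Fréchet space is almost open: the closure of the image of a ball
contains a ball. The map need not be continuous. -/
theorem IsFrechetSeminorms.almost_open {p : ℕ → Seminorm ℂ E} (hp : IsFrechetSeminorms p)
    (q : Seminorm ℂ G) {Θ : G →ₗ[ℂ] E} (hΘ : Function.Surjective Θ) :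
    ∃ m, ∃ K : ℝ, 0 < K ∧ ∀ t : ℝ, 0 < t → ∀ y, p m y < t → ∀ l, ∀ ε : ℝ, 0 < ε →
      ∃ g, q g ≤ K * t ∧ p l (y - Θ g) < ε := by
  obtain ⟨n, x, m, δ, hδ, h⟩ := hp.baire (C := fun n : ℕ => {e | ∃ g, Θ g = e ∧ q g ≤ n}) (by
    refine Set.eq_univ_of_forall fun e => ?_
    obtain ⟨g, rfl⟩ := hΘ e
    obtain ⟨n, hn⟩ := exists_nat_ge (q g)
    exact Set.mem_iUnion.2 ⟨n, g, rfl, hn⟩)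
  refine ⟨m, (2 * n + 1) / δ, by positivity, fun t ht y hy l ε hε => ?_⟩
  have hε' : 0 < ε * (δ / t) / 2 := by positivity
  obtain ⟨_, ⟨g₁, rfl, hg₁⟩, h₁⟩ := h x (by simpa using hδ) l _ hε'
  obtain ⟨_, ⟨g₂, rfl, hg₂⟩, h₂⟩ := h (x + ((δ / t : ℝ) : ℂ) • y) (by
    rw [add_sub_cancel_left, Seminorm.map_real_smul _ (by positivity), div_mul_eq_mul_div,
      div_lt_iff₀ ht]
    exact mul_lt_mul_of_pos_left hy hδ) l _ hε'
  refine ⟨((t / δ : ℝ) : ℂ) • (g₂ - g₁), ?_, ?_⟩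
  · rw [Seminorm.map_real_smul _ (by positivity)]
    have h3 : q (g₂ - g₁) ≤ 2 * n + 1 := by
      have := map_sub_le_add q g₂ g₁
      linarith
    calc t / δ * q (g₂ - g₁) ≤ t / δ * (2 * n + 1) := by gcongr
      _ = (2 * n + 1) / δ * t := by ring
  · have hy' : y - Θ (((t / δ : ℝ) : ℂ) • (g₂ - g₁)) =
        ((t / δ : ℝ) : ℂ) • ((x + ((δ / t : ℝ) : ℂ) • y - Θ g₂) - (x - Θ g₁)) := by
      have h4 : ((t / δ : ℝ) : ℂ) * ((δ / t : ℝ) : ℂ) = 1 := by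
        rw [← Complex.ofReal_mul, div_mul_div_cancel₀ hδ.ne', div_self ht.ne', Complex.ofReal_one]
      rw [map_smul, map_sub]
      have h5 : x + ((δ / t : ℝ) : ℂ) • y - Θ g₂ - (x - Θ g₁) =
        ((δ / t : ℝ) : ℂ) • y - (Θ g₂ - Θ g₁) := by abel
      rw [h5, smul_sub _ (_ • y), smul_smul, h4, one_smul]
    rw [hy', Seminorm.map_real_smul _ (by positivity)]
    have h6 := map_sub_le_add (p l) (x + ((δ / t : ℝ) : ℂ) • y - Θ g₂) (x - Θ g₁)
    calc _ < t / δ * (ε * (δ / t)) := by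
          apply mul_lt_mul_of_pos_left _ (by positivity); linarith
      _ = ε := by field_simp

/-- A common form of the closed graph and open mapping theorems. Let `Θ` be a linear map, not
necessarily continuous, from one Fréchet space onto another, and let `r` be a continuous seminorm on
the source that vanishes on the limits of sequences `u` with `Θ u → 0`. Then `r` descends to a
continuous seminorm on the target. For bijective `Θ` with `Θ⁻¹` of closed graph this is the
continuity of `Θ⁻¹`; for continuous `Θ` those limits form the kernel, and `Θ` is open. -/
theorem IsFrechetSeminorms.exists_bound {p : ℕ → Seminorm ℂ E} {q : ℕ → Seminorm ℂ G}
    (hp : IsFrechetSeminorms p) (hq : IsFrechetSeminorms q) {Θ : G →ₗ[ℂ] E}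
    (hΘ : Function.Surjective Θ) {r : Seminorm ℂ G} {C : ℝ} {k : ℕ} (hr : ∀ g, r g ≤ C * q k g)
    (hsep : ∀ g, (∀ m, ∀ ε : ℝ, 0 < ε → ∃ u, p m (Θ u) < ε ∧ q m (g - u) < ε) → r g = 0) :
    ∃ m, ∃ D : ℝ, 0 ≤ D ∧ ∀ g, r g ≤ D * p m (Θ g) := by
  wlog hC : 0 ≤ C generalizing C
  · refine this (C := 0) (fun g => ?_) le_rfl
    have := hr g
    have := mul_nonneg (sub_nonneg.2 (not_le.1 hC).le) (apply_nonneg (q k) g)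
    linarith
  -- The seminorms of the source are used from the index `k` on, as `r` is controlled by `q k`.
  choose M K hK hM using fun i => hp.almost_open (q (i + k)) hΘ
  have ht : ∀ i, ∃ t : ℝ, 0 < t ∧ K i * t ≤ (1 / 2) ^ i ∧ t ≤ (1 / 2) ^ i := fun i =>
    ⟨min ((1 / 2) ^ i / K i) ((1 / 2) ^ i), lt_min (div_pos (by positivity) (hK i)) (by positivity),
      by
        rw [mul_comm, ← le_div_iff₀ (hK i)]
        exact min_le_left _ _, min_le_right _ _⟩
  choose t ht0 htK ht2 using ht
  -- Successive approximation: `h` is replaced by `h'` close to it and with a smaller image.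
  have hstep : ∀ i h, p (max (M i) i) (Θ h) < t i → ∃ h', q (i + k) (h' - h) ≤ (1 / 2) ^ i ∧
      p (max (M (i + 1)) (i + 1)) (Θ h') < t (i + 1) := by
    intro i h hh
    obtain ⟨v, hv, hv'⟩ := hM i (t i) (ht0 i) (Θ h) ((hp.mono (le_max_left _ _) _).trans_lt hh)
      (max (M (i + 1)) (i + 1)) (t (i + 1)) (ht0 _)
    exact ⟨h - v, by simpa [sub_sub_cancel_left] using hv.trans (htK i), by simpa using hv'⟩
  choose! next hnext₁ hnext₂ using hstep
  have hball : ∀ g, p (max (M 0) 0) (Θ g) < t 0 → r g ≤ 2 * C := by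
    intro g hg
    let h : ℕ → G := fun n => Nat.rec g (fun i h => next i h) n
    have hsmall : ∀ i, p (max (M i) i) (Θ (h i)) < t i := by
      intro i
      induction i with
      | zero => exact hg
      | succ i ih => exact hnext₂ i _ ih
    have hdiff : ∀ i, q (i + k) (h (i + 1) - h i) ≤ (1 / 2) ^ i := fun i => hnext₁ i _ (hsmall i)
    obtain ⟨x, hx⟩ := hq.complete_of_geometric
      (fun n => (hq.mono (Nat.le_add_right n k) _).trans (hdiff n))
    have hrx : r x = 0 := by
      refine hsep x fun m ε hε => ?_
      obtain ⟨N, hN⟩ := exists_pow_lt_of_lt_one hε (show (1 / 2 : ℝ) < 1 by norm_num)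
      obtain ⟨n, hn₁, hn₂⟩ := (((hx m).eventually_lt_const hε).and
        (eventually_ge_atTop (max m N))).exists
      refine ⟨h n, ?_, by rwa [map_sub_rev]⟩
      calc p m (Θ (h n)) ≤ p (max (M n) n) (Θ (h n)) :=
            hp.mono ((le_max_left _ _).trans (hn₂.trans (le_max_right _ _))) _
        _ < t n := hsmall n
        _ ≤ (1 / 2) ^ n := ht2 n
        _ ≤ (1 / 2) ^ N :=
            pow_le_pow_of_le_one (by norm_num) (by norm_num) ((le_max_right _ _).trans hn₂)
        _ < ε := hN
    have hsum : ∀ n, r (g - h n) ≤ C * (2 - 2 * (1 / 2) ^ n) := by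
      intro n
      induction n with
      | zero => simp [h]
      | succ n ih =>
        have h1 := map_add_le_add r (g - h n) (h n - h (n + 1))
        rw [sub_add_sub_cancel, map_sub_rev r (h n)] at h1
        have h2 := (hr (h (n + 1) - h n)).trans (mul_le_mul_of_nonneg_left
          ((hq.mono (Nat.le_add_left k n) _).trans (hdiff n)) hC)
        rw [pow_succ]
        linarith
    have hlim : Tendsto (fun n => 2 * C + C * q k (h n - x)) atTop (𝓝 (2 * C + C * 0)) :=
      ((hx k).const_mul C).const_add _
    rw [mul_zero, add_zero] at hlim
    refine ge_of_tendsto hlim (Eventually.of_forall fun n => ?_)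
    have h1 := map_add_le_add r (g - h n) (h n - x + x)
    have h2 := map_add_le_add r (h n - x) x
    have h3 := hr (h n - x)
    have h4 := hsum n
    have h5 : 0 ≤ C * (1 / 2) ^ n := by positivity
    rw [sub_add_cancel, sub_add_cancel] at h1
    rw [sub_add_cancel] at h2
    linarith
  -- Homogeneity turns the bound on a ball into a linear bound. The summand `1 / (n + 1)` allows the
  -- seminorm of `Θ g` to vanish.
  refine ⟨max (M 0) 0, 2 * C / t 0, div_nonneg (by positivity) (ht0 0).le, fun g => ?_⟩
  have hlim : Tendsto (fun n : ℕ => 2 * C / t 0 * (p (max (M 0) 0) (Θ g) + 1 / ((n : ℝ) + 1))) atTop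
      (𝓝 (2 * C / t 0 * (p (max (M 0) 0) (Θ g) + 0))) :=
    (tendsto_one_div_add_atTop_nhds_zero_nat.const_add _).const_mul _
  rw [add_zero] at hlim
  refine ge_of_tendsto hlim (Eventually.of_forall fun n => ?_)
  have hP : 0 < p (max (M 0) 0) (Θ g) + 1 / ((n : ℝ) + 1) := by positivity
  set P := p (max (M 0) 0) (Θ g) + 1 / ((n : ℝ) + 1) with hPdef
  have h1 := hball (((t 0 / P : ℝ) : ℂ) • g) (by
    rw [map_smul, Seminorm.map_real_smul _ (div_nonneg (ht0 0).le hP.le), div_mul_eq_mul_div,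
      div_lt_iff₀ hP]
    refine mul_lt_mul_of_pos_left ?_ (ht0 0)
    rw [hPdef, lt_add_iff_pos_right]
    positivity)
  rw [Seminorm.map_real_smul _ (div_nonneg (ht0 0).le hP.le), div_mul_eq_mul_div,
      div_le_iff₀ hP] at h1
  rw [div_mul_eq_mul_div, le_div_iff₀ (ht0 0)]
  linarith

end Frechet

/-! ### Quotient seminorms -/

section Quotient

variable {E : Type*} [AddCommGroup E] [Module ℂ E]

/-- The quotient seminorm of `q` modulo the subspace `W`, as a seminorm on the whole space: the
`q`-distance to `W`. -/
noncomputable def Seminorm.quotientBy (q : Seminorm ℂ E) (W : Submodule ℂ E) : Seminorm ℂ E :=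
  Seminorm.ofSMulLE (fun x => ⨅ w : W, q (x - w))
    (le_antisymm (ciInf_le_of_le ⟨0, by rintro _ ⟨w, rfl⟩; exact apply_nonneg q _⟩ 0 (by simp))
      (le_ciInf fun w => apply_nonneg q _))
    (fun x y => by
      refine le_of_forall_pos_lt_add fun ε hε => ?_
      obtain ⟨v, hv⟩ := exists_lt_of_ciInf_lt (lt_add_of_pos_right (⨅ w : W, q (x - w)) (half_pos hε))
      obtain ⟨w, hw⟩ := exists_lt_of_ciInf_lt (lt_add_of_pos_right (⨅ w : W, q (y - w)) (half_pos hε))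
      refine (ciInf_le ⟨0, by rintro _ ⟨w, rfl⟩; exact apply_nonneg q _⟩ (v + w)).trans_lt ?_
      have h := map_add_le_add q (x - v) (y - w)
      rw [show x - v + (y - w) = x + y - ((v + w : W) : E) by push_cast; abel] at h
      linarith)
    (fun c x => by
      rw [Real.mul_iInf_of_nonneg (norm_nonneg c)]
      refine le_ciInf fun w => ?_
      refine (ciInf_le ⟨0, by rintro _ ⟨w, rfl⟩; exact apply_nonneg q _⟩ (c • w)).trans ?_
      rw [Submodule.coe_smul, ← smul_sub, map_smul_eq_mul])

namespace Seminorm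

theorem quotientBy_le_sub (q : Seminorm ℂ E) {W : Submodule ℂ E} (x : E) {w : E} (hw : w ∈ W) :
    q.quotientBy W x ≤ q (x - w) :=
  ciInf_le (f := fun w : W => q (x - w)) ⟨0, by rintro _ ⟨w, rfl⟩; exact apply_nonneg q _⟩ ⟨w, hw⟩

theorem quotientBy_le (q : Seminorm ℂ E) (W : Submodule ℂ E) (x : E) : q.quotientBy W x ≤ q x := by
  simpa using q.quotientBy_le_sub x W.zero_mem

theorem quotientBy_eq_zero (q : Seminorm ℂ E) {W : Submodule ℂ E} {w : E} (hw : w ∈ W) :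
    q.quotientBy W w = 0 :=
  le_antisymm (by simpa using q.quotientBy_le_sub w hw) (apply_nonneg _ _)

end Seminorm

end Quotient

/-- An increasing sequence of submultiplicative seminorms that turns `A` into a Fréchet algebra. -/
structure IsFrechetAlgebraSeminorms {A : Type*} [CommRing A] [Algebra ℂ A]
    (p : ℕ → Seminorm ℂ A) : Prop extends IsFrechetSeminorms p where
  mul_le : ∀ m x y, p m (x * y) ≤ p m x * p m y

/-! ### The separating ideal and the stability lemma -/

section Separating

variable {A : Type*} [CommRing A] [Algebra ℂ A] {p q : ℕ → Seminorm ℂ A}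

/-- The separating ideal of two Fréchet algebra structures on `A`: the elements `s` that are the
limit for `q` of a sequence that tends to `0` for `p`. As the seminorms increase, a single index `m`
may be used for both sequences. -/
def separatingIdeal (hp : IsFrechetAlgebraSeminorms p) (hq : IsFrechetAlgebraSeminorms q) :
    Ideal A where
  carrier := {s | ∀ m, ∀ ε : ℝ, 0 < ε → ∃ u, p m u < ε ∧ q m (s - u) < ε}
  zero_mem' := fun m ε hε => ⟨0, by simpa, by simpa⟩
  add_mem' := by
    intro s t hs ht m ε hε
    obtain ⟨u, hu₁, hu₂⟩ := hs m _ (half_pos hε)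
    obtain ⟨v, hv₁, hv₂⟩ := ht m _ (half_pos hε)
    refine ⟨u + v, ?_, ?_⟩
    · have := map_add_le_add (p m) u v
      linarith
    · have := map_add_le_add (q m) (s - u) (t - v)
      rw [sub_add_sub_comm] at this
      linarith
  smul_mem' := by
    intro c s hs m ε hε
    have hpc := apply_nonneg (p m) c
    have hqc := apply_nonneg (q m) c
    have hδ : 0 < ε / (1 + p m c + q m c) := by positivity
    have hε' : (1 + p m c + q m c) * (ε / (1 + p m c + q m c)) = ε := by field_simp
    obtain ⟨u, hu₁, hu₂⟩ := hs m _ hδ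
    set δ := ε / (1 + p m c + q m c)
    refine ⟨c * u, ?_, ?_⟩
    · have h1 := hp.mul_le m c u
      have h2 := mul_le_mul_of_nonneg_left hu₁.le hpc
      have h3 := mul_nonneg hqc hδ.le
      linarith
    · have h1 := hq.mul_le m c (s - u)
      have h2 := mul_le_mul_of_nonneg_left hu₂.le hqc
      have h3 := mul_nonneg hpc hδ.le
      rw [smul_eq_mul, ← mul_sub]
      linarith

variable (hp : IsFrechetAlgebraSeminorms p) (hq : IsFrechetAlgebraSeminorms q)

theorem separatingIdeal_comm : separatingIdeal hp hq = separatingIdeal hq hp := by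
  ext s
  constructor <;>
  · intro hs m ε hε
    obtain ⟨u, hu₁, hu₂⟩ := hs m ε hε
    exact ⟨s - u, hu₂, by rwa [sub_sub_cancel]⟩

/-- The separating ideal is closed for `q`; by `separatingIdeal_comm` it is closed for `p` as well. -/
theorem separatingIdeal_isClosed {s : A}
    (hs : ∀ m, ∀ ε : ℝ, 0 < ε → ∃ t ∈ separatingIdeal hp hq, q m (s - t) < ε) :
    s ∈ separatingIdeal hp hq := by
  intro m ε hε
  obtain ⟨t, ht, hst⟩ := hs m _ (half_pos hε)
  obtain ⟨u, hu₁, hu₂⟩ := ht m _ (half_pos hε)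
  refine ⟨u, by linarith, ?_⟩
  have := map_add_le_add (q m) (s - t) (t - u)
  rw [sub_add_sub_cancel] at this
  linarith

/-- Finitely many seminorms that are bounded by members of an increasing sequence have a
common bound. -/
theorem exists_common_bound {E : Type*} [AddCommGroup E] [Module ℂ E] {p : ℕ → Seminorm ℂ E}
    (hp : Monotone p) {ι : Type*} (t : Finset ι) (r : ι → E → ℝ)
    (h : ∀ i, ∃ M, ∃ D : ℝ, 0 ≤ D ∧ ∀ a, r i a ≤ D * p M a) :
    ∃ M, ∃ D : ℝ, 0 < D ∧ ∀ i ∈ t, ∀ a, r i a ≤ D * p M a := by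
  choose M D hD hr using h
  refine ⟨t.sup M, 1 + ∑ i ∈ t, D i, add_pos_of_pos_of_nonneg one_pos
    (Finset.sum_nonneg fun i _ => hD i), fun i hi a => (hr i a).trans ?_⟩
  refine mul_le_mul ?_ (hp (Finset.le_sup hi) a) (apply_nonneg _ _)
    (add_nonneg zero_le_one (Finset.sum_nonneg fun i _ => hD i))
  have := Finset.single_le_sum (fun i _ => hD i) hi
  linarith

/-- The stability lemma: for each seminorm `q m`, the `q m`-closures of the ideals `f ^ n * S`,
where `S` is the separating ideal, are eventually constant. -/
theorem separatingIdeal_stability (f : A) (m : ℕ) :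
    ∃ N, ∀ n, N ≤ n → ∀ s ∈ separatingIdeal hp hq, ∀ ε : ℝ, 0 < ε →
      ∃ s' ∈ separatingIdeal hp hq, q m (f ^ n * s - f ^ (n + 1) * s') < ε := by
  set S := separatingIdeal hp hq
  let W : ℕ → Submodule ℂ A := fun n =>
    (S.restrictScalars ℂ).map (LinearMap.mulLeft ℂ (f ^ n))
  have hW : ∀ n, ∀ s ∈ S, f ^ n * s ∈ W n := fun n s hs => ⟨s, hs, rfl⟩
  let d : ℕ → Seminorm ℂ A := fun n => (q m).quotientBy (W n)
  have hdq : ∀ n x, d n x ≤ q m x := fun n => (q m).quotientBy_le (W n)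
  -- `f ^ n * S` is killed by `d n`, so `a ↦ d n (f ^ n * a)` is continuous for `p`.
  have hcont : ∀ n, ∃ M, ∃ D : ℝ, 0 ≤ D ∧ ∀ a, d n (f ^ n * a) ≤ D * p M a := fun n =>
    hp.exists_bound hq.toIsFrechetSeminorms (Θ := LinearMap.id) Function.surjective_id
      (r := (d n).comp (LinearMap.mulLeft ℂ (f ^ n))) (C := q m (f ^ n)) (k := m)
      (fun g => (hdq n _).trans (hq.mul_le m _ _))
      (fun g hg => (q m).quotientBy_eq_zero (hW n g hg))
  by_contra! hcon
  -- `I` is the set of those `n` for which the `q m`-closure of `f ^ (n + 1) * S` is strictly smaller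
  -- than that of `f ^ n * S`.
  let I : Set ℕ := {n | ∃ s ∈ S, 0 < d (n + 1) (f ^ n * s)}
  have hI : ∀ N, ∃ n, N ≤ n ∧ n ∈ I := by
    intro N
    obtain ⟨n, hn, s, hs, ε, hε, h⟩ := hcon N
    refine ⟨n, hn, s, hs, hε.trans_le ?_⟩
    refine le_ciInf fun w => ?_
    obtain ⟨s', hs', hw⟩ := w.2
    rw [← hw]
    exact h s' hs'
  -- For `n ∈ I` the seminorm `a ↦ d (n + 1) (f ^ n * a)` is not continuous for `p`.
  have hlarge : ∀ n ∈ I, ∀ l, ∀ ε : ℝ, 0 < ε → ∀ R : ℝ,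
      ∃ a, p l a < ε ∧ R < d (n + 1) (f ^ n * a) := by
    rintro n ⟨s, hs, hds⟩ l ε hε R
    set c := d (n + 1) (f ^ n * s) with hc
    have hf := apply_nonneg (q m) (f ^ n)
    set T := (|R| + 1) * 2 / c with hT
    have hT0 : 0 < T := by positivity
    obtain ⟨u, hu₁, hu₂⟩ := hs (max l m) (min (ε / T) (c / 2 / (q m (f ^ n) + 1))) (by positivity)
    refine ⟨((T : ℝ) : ℂ) • u, ?_, ?_⟩
    · rw [Seminorm.map_real_smul _ hT0.le, mul_comm, ← lt_div_iff₀ hT0]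
      exact (hp.mono (le_max_left _ _) _).trans_lt (hu₁.trans_le (min_le_left _ _))
    · rw [mul_smul_comm, Seminorm.map_real_smul _ hT0.le]
      have h1 : q m (f ^ n * (s - u)) ≤ c / 2 := by
        refine (hq.mul_le m _ _).trans ?_
        have h2 := (hq.mono (le_max_right l m) (s - u)).trans (hu₂.le.trans (min_le_right _ _))
        have h3 : (q m (f ^ n) + 1) * (c / 2 / (q m (f ^ n) + 1)) = c / 2 := by field_simp
        have h4 := mul_le_mul_of_nonneg_left h2 hf
        have h5 : 0 < c / 2 / (q m (f ^ n) + 1) := by positivity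
        linarith
      have h2 := map_add_le_add (d (n + 1)) (f ^ n * (s - u)) (f ^ n * u)
      rw [← mul_add, sub_add_cancel, ← hc] at h2
      have h3 := hdq (n + 1) (f ^ n * (s - u))
      have h4 : c / 2 ≤ d (n + 1) (f ^ n * u) := by linarith
      have h5 : T * (c / 2) = |R| + 1 := by rw [hT]; field_simp
      have h6 := mul_le_mul_of_nonneg_left h4 hT0.le
      have h7 := le_abs_self R
      linarith
  -- One step of the gliding hump: `a` is small for finitely many `p`-continuous seminorms.
  have hstep : ∀ n (x : A), ∃ a, (∀ j ≤ n, p n (f ^ j * a) ≤ (1 / 2) ^ n) ∧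
      (∀ j ≤ n, d j (f ^ n * a) ≤ (1 / 2) ^ n) ∧
      (n ∈ I → n + 2 + q m x < d (n + 1) (f ^ n * a)) := by
    intro n x
    by_cases hn : n ∈ I
    · obtain ⟨M₁, D₁, hD₁, h₁⟩ := exists_common_bound hp.mono (Finset.range (n + 1))
        (fun j a => p n (f ^ j * a)) (fun j => ⟨n, p n (f ^ j), apply_nonneg _ _, hp.mul_le n _⟩)
      obtain ⟨M₂, D₂, hD₂, h₂⟩ := exists_common_bound hp.mono (Finset.range (n + 1))
        (fun j a => d j (f ^ j * (f ^ (n - j) * a))) (fun j => by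
          obtain ⟨M, D, hD, h⟩ := hcont j
          refine ⟨M, D * p M (f ^ (n - j)), mul_nonneg hD (apply_nonneg _ _), fun a => ?_⟩
          rw [mul_assoc]
          exact (h _).trans (mul_le_mul_of_nonneg_left (hp.mul_le M _ _) hD))
      obtain ⟨a, ha, ha'⟩ := hlarge n hn (max M₁ M₂) (min ((1 / 2) ^ n / D₁) ((1 / 2) ^ n / D₂))
        (by positivity) (n + 2 + q m x)
      refine ⟨a, fun j hj => ?_, fun j hj => ?_, fun _ => ha'⟩
      · refine (h₁ j (Finset.mem_range_succ_iff.2 hj) a).trans ?_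
        rw [mul_comm, ← le_div_iff₀ hD₁]
        exact (hp.mono (le_max_left _ _) _).trans (ha.le.trans (min_le_left _ _))
      · have h := h₂ j (Finset.mem_range_succ_iff.2 hj) a
        simp only [← mul_assoc, ← pow_add, Nat.add_sub_cancel' hj] at h
        refine h.trans ?_
        rw [mul_comm, ← le_div_iff₀ hD₂]
        exact (hp.mono (le_max_right _ _) _).trans (ha.le.trans (min_le_right _ _))
    · exact ⟨0, by simp, by simp, fun h => absurd h hn⟩
  choose next hnext₁ hnext₂ hnext₃ using hstep
  -- `x n` is the partial sum `∑ i < n, f ^ i * a i`, and `z` its limit.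
  let x : ℕ → A := fun n => Nat.rec 0 (fun n x => x + f ^ n * next n x) n
  let a : ℕ → A := fun n => next n (x n)
  have hx : ∀ n, x (n + 1) = x n + f ^ n * a n := fun n => rfl
  obtain ⟨z, hz⟩ := hp.complete_of_geometric (u := x) (fun n => by
    rw [hx, add_sub_cancel_left]
    exact hnext₁ n _ n le_rfl)
  -- The tail is `f ^ j * w` with `w = ∑ i, f ^ i * a (j + i)`, so `d j` may be computed termwise.
  have htail : ∀ j, d j (z - x j) ≤ 2 := by
    intro j
    let y : ℕ → A := fun n => ∑ i ∈ Finset.range n, f ^ i * a (j + i)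
    have hxy : ∀ n, x (j + n) = x j + f ^ j * y n := by
      intro n
      induction n with
      | zero => simp [y]
      | succ n ih =>
        rw [← add_assoc, hx, ih]
        simp only [y, Finset.sum_range_succ]
        rw [pow_add]
        ring
    obtain ⟨w, hw⟩ := hp.complete_of_geometric (u := y) (fun n => by
      simp only [y, Finset.sum_range_succ, add_sub_cancel_left]
      refine (hp.mono (Nat.le_add_left n j) _).trans ((hnext₁ (j + n) _ n (by omega)).trans ?_)
      exact pow_le_pow_of_le_one (by norm_num) (by norm_num) (by omega))
    have hzw : z - x j = f ^ j * w := by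
      refine sub_eq_zero.1 (hp.eq_zero _ fun l => le_antisymm ?_ (apply_nonneg _ _))
      have hlim : Tendsto (fun n => p l (x (j + n) - z) + p l (f ^ j) * p l (y n - w)) atTop
          (𝓝 (0 + p l (f ^ j) * 0)) := by
        refine Tendsto.add ?_ ((hw l).const_mul _)
        have := (tendsto_add_atTop_iff_nat j).2 (hz l)
        simpa only [add_comm j] using this
      rw [mul_zero, add_zero] at hlim
      refine ge_of_tendsto hlim (Eventually.of_forall fun n => ?_)
      have h1 := hp.mul_le l (f ^ j) (y n - w)
      have h2 := map_sub_le_add (p l) (f ^ j * (y n - w)) (x (j + n) - z)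
      rw [show f ^ j * (y n - w) - (x (j + n) - z) = z - x j - f ^ j * w by rw [hxy]; ring] at h2
      linarith
    obtain ⟨M, D, hD, hbd⟩ := hcont j
    have hfin : ∀ n, d j (f ^ j * y n) ≤ 2 - 2 * (1 / 2) ^ n := by
      intro n
      induction n with
      | zero => simp [y]
      | succ n ih =>
        simp only [y, Finset.sum_range_succ]
        rw [mul_add, ← mul_assoc, ← pow_add]
        have h1 := map_add_le_add (d j) (f ^ j * y n) (f ^ (j + n) * a (j + n))
        have h2 := hnext₂ (j + n) (x (j + n)) j (by omega)
        have h3 : (1 / 2 : ℝ) ^ (j + n) ≤ (1 / 2) ^ n :=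
          pow_le_pow_of_le_one (by norm_num) (by norm_num) (by omega)
        rw [pow_succ]
        refine h1.trans ?_
        change d j (f ^ (j + n) * a (j + n)) ≤ _ at h2
        linarith
    have hlim : Tendsto (fun n => 2 + D * p M (y n - w)) atTop (𝓝 (2 + D * 0)) :=
      ((hw M).const_mul _).const_add _
    rw [mul_zero, add_zero] at hlim
    rw [hzw]
    refine ge_of_tendsto hlim (Eventually.of_forall fun n => ?_)
    have h1 := map_sub_le_add (d j) (f ^ j * y n) (f ^ j * (y n - w))
    rw [← mul_sub, sub_sub_cancel] at h1
    have h2 := hfin n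
    have h3 := hbd (y n - w)
    have h4 : (0 : ℝ) < (1 / 2) ^ n := by positivity
    linarith
  -- For `n ∈ I` the hump `f ^ n * a n` forces `q m z ≥ d (n + 1) z > n`.
  obtain ⟨N, hN⟩ := exists_nat_ge (q m z)
  obtain ⟨n, hn, hnI⟩ := hI N
  have h1 := hnext₃ n (x n) hnI
  have h2 := htail (n + 1)
  have h3 := hdq (n + 1) z
  have h4 := hdq (n + 1) (x n)
  have h5 := map_sub_le_add (d (n + 1)) z (z - x (n + 1) + x n)
  have h6 := map_add_le_add (d (n + 1)) (z - x (n + 1)) (x n)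
  rw [show z - (z - x (n + 1) + x n) = f ^ n * a n by rw [hx]; ring] at h5
  have h7 : (N : ℝ) ≤ n := by exact_mod_cast hn
  change _ < d (n + 1) (f ^ n * a n) at h1
  linarith

/-- Iterated form of the stability lemma, for several elements at once. -/
theorem separatingIdeal_stability_finite {ι : Type*} [Finite ι] (f : ι → A) (m : ℕ) :
    ∃ N, ∀ i, ∀ n, N ≤ n → ∀ s ∈ separatingIdeal hp hq, ∀ ε : ℝ, 0 < ε → ∀ j,
      ∃ s' ∈ separatingIdeal hp hq, q m (f i ^ n * s - f i ^ (n + j) * s') < ε := by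
  choose N hN using fun i => separatingIdeal_stability hp hq (f i) m
  obtain ⟨B, hB⟩ := Finite.exists_le N
  refine ⟨B, fun i n hn s hs ε hε j => ?_⟩
  induction j generalizing ε with
  | zero => exact ⟨s, hs, by simpa⟩
  | succ j ih =>
    obtain ⟨s₁, hs₁, h₁⟩ := ih _ (half_pos hε)
    obtain ⟨s₂, hs₂, h₂⟩ := hN i (n + j) ((hB i).trans (hn.trans (Nat.le_add_right n j))) s₁ hs₁ _
      (half_pos hε)
    refine ⟨s₂, hs₂, ?_⟩
    have := map_add_le_add (q m) (f i ^ n * s - f i ^ (n + j) * s₁)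
      (f i ^ (n + j) * s₁ - f i ^ (n + j + 1) * s₂)
    rw [sub_add_sub_cancel] at this
    rw [← add_assoc]
    linarith

end Separating

/-! ### Density of the ideals generated by powers -/

section PowIdeal

variable {A ι : Type*} [CommRing A] [Fintype ι]

/-- The ideal `∑ i, f i ^ n * S`. -/
def powIdeal (f : ι → A) (S : Ideal A) (n : ℕ) : Ideal A where
  carrier := {a | ∃ s : ι → A, (∀ i, s i ∈ S) ∧ ∑ i, f i ^ n * s i = a}
  zero_mem' := ⟨0, fun _ => S.zero_mem, by simp⟩
  add_mem' := by
    rintro _ _ ⟨s, hs, rfl⟩ ⟨t, ht, rfl⟩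
    exact ⟨s + t, fun i => S.add_mem (hs i) (ht i), by simp [mul_add, Finset.sum_add_distrib]⟩
  smul_mem' := by
    rintro c _ ⟨s, hs, rfl⟩
    refine ⟨fun i => c * s i, fun i => S.mul_mem_left c (hs i), ?_⟩
    rw [smul_eq_mul, Finset.mul_sum]
    exact Finset.sum_congr rfl fun i _ => by ring

theorem powIdeal_le (f : ι → A) (S : Ideal A) (n : ℕ) : powIdeal f S n ≤ S := by
  rintro _ ⟨s, hs, rfl⟩
  exact S.sum_mem fun i _ => S.mul_mem_left _ (hs i)

theorem pow_mul_mem_powIdeal (f : ι → A) {S : Ideal A} (n : ℕ) (i : ι) {s : A} (hs : s ∈ S) :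
    f i ^ n * s ∈ powIdeal f S n := by
  classical
  refine ⟨Pi.single i s, fun j => ?_, ?_⟩
  · rcases eq_or_ne j i with rfl | h
    · simpa
    · simp [h]
  · rw [Finset.sum_eq_single i (fun j _ h => by simp [h]) (by simp)]
    simp

/-- In the seminorm `q m`, the ideals `∑ i, f i ^ n * S` with `n` large are dense in one another. -/
theorem separatingIdeal_powIdeal_dense [Algebra ℂ A] {p q : ℕ → Seminorm ℂ A}
    (hp : IsFrechetAlgebraSeminorms p) (hq : IsFrechetAlgebraSeminorms q) (f : ι → A) (m : ℕ) :
    ∃ N, ∀ n, N ≤ n → ∀ a ∈ powIdeal f (separatingIdeal hp hq) n, ∀ n', n ≤ n' →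
      ∀ ε : ℝ, 0 < ε → ∃ b ∈ powIdeal f (separatingIdeal hp hq) n', q m (a - b) < ε := by
  obtain ⟨N, hN⟩ := separatingIdeal_stability_finite hp hq f m
  refine ⟨N, fun n hn a ha n' hn' ε hε => ?_⟩
  obtain ⟨j, rfl⟩ := Nat.exists_eq_add_of_le hn'
  obtain ⟨s, hs, rfl⟩ := ha
  have hδ : 0 < ε / (Fintype.card ι + 1) := by positivity
  choose t ht hst using fun i => hN i n hn (s i) (hs i) _ hδ j
  refine ⟨_, ⟨t, ht, rfl⟩, ?_⟩
  rw [← Finset.sum_sub_distrib]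
  calc q m (∑ i, (f i ^ n * s i - f i ^ (n + j) * t i))
      ≤ ∑ i, q m (f i ^ n * s i - f i ^ (n + j) * t i) :=
        Finset.le_sum_of_subadditive _ (map_zero _).le (fun x y => map_add_le_add _ x y) _ _
    _ ≤ ∑ _i : ι, ε / (Fintype.card ι + 1) := Finset.sum_le_sum fun i _ => (hst i).le
    _ = Fintype.card ι * (ε / (Fintype.card ι + 1)) := by simp
    _ < (Fintype.card ι + 1) * (ε / (Fintype.card ι + 1)) :=
        mul_lt_mul_of_pos_right (by linarith) hδ
    _ = ε := by field_simp

end PowIdeal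

/-! ### Power series and truncation to a box -/

namespace MvPowerSeries

variable {k : ℕ}

/-- The exponent with all entries equal to `n`: the exponents below it are those whose entries are all
at most `n`. -/
noncomputable def boxExp (k n : ℕ) : Fin k →₀ ℕ := Finsupp.equivFunOnFinite.symm fun _ => n

theorem coeff_mul_eq_zero {R : Type*} [CommRing R] {F : MvPowerSeries (Fin k) R} {β : Fin k →₀ ℕ}
    (hF : ∀ γ ≤ β, coeff γ F = 0) (G : MvPowerSeries (Fin k) R) : coeff β (F * G) = 0 := by
  classical
  rw [coeff_mul]
  refine Finset.sum_eq_zero fun x hx => ?_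
  rw [hF _ (Finset.HasAntidiagonal.mem_antidiagonal.1 hx ▸ le_self_add), zero_mul]

theorem coeff_X_pow_mul_eq_zero {R : Type*} [CommRing R] {β : Fin k →₀ ℕ} {n : ℕ} {i : Fin k}
    (hβ : β i < n) (F : MvPowerSeries (Fin k) R) : coeff β (X i ^ n * F) = 0 := by
  classical
  refine coeff_mul_eq_zero (fun γ hγ => ?_) F
  rw [coeff_X_pow, if_neg]
  rintro rfl
  have := hγ i
  simp at this
  omega

/-- A power series all of whose exponents have an entry `≥ n` lies in the ideal generated by the
`n`-th powers of the indeterminates. -/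
theorem exists_eq_sum_X_pow_mul {R : Type*} [CommRing R] (n : ℕ) (F : MvPowerSeries (Fin k) R)
    (hF : ∀ β, (∀ i, β i < n) → coeff β F = 0) :
    ∃ g : Fin k → MvPowerSeries (Fin k) R, F = ∑ i, X i ^ n * g i := by
  classical
  -- A monomial is assigned to the first `i` for which its `i`-th exponent is at least `n`.
  let g : Fin k → MvPowerSeries (Fin k) R := fun i γ =>
    if ∀ j < i, γ j < n then coeff (γ + Finsupp.single i n) F else 0
  have hg : ∀ i γ, coeff γ (g i) =
      if ∀ j < i, γ j < n then coeff (γ + Finsupp.single i n) F else 0 := fun _ _ => rfl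
  refine ⟨g, ?_⟩
  ext β
  have hterm : ∀ i : Fin k, coeff β (X i ^ n * g i) =
      if n ≤ β i ∧ ∀ j < i, β j < n then coeff β F else 0 := by
    intro i
    rw [X_pow_eq, coeff_monomial_mul, one_mul]
    by_cases h : n ≤ β i
    · have hle : Finsupp.single i n ≤ β := Finsupp.single_le_iff.2 h
      have hj : (∀ j < i, (β - Finsupp.single i n) j < n) ↔ ∀ j < i, β j < n := by
        refine forall_congr' fun j => imp_congr_right fun hj => ?_
        simp [hj.ne']
      rw [if_pos hle, hg]
      simp only [hj, h, true_and, tsub_add_cancel_of_le hle]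
    · rw [if_neg (fun h' => h (Finsupp.single_le_iff.1 h')), if_neg (fun h' => h h'.1)]
  rw [map_sum, Finset.sum_congr rfl fun i _ => hterm i]
  by_cases h : ∀ i, β i < n
  · rw [hF β h]
    simp
  · push Not at h
    obtain ⟨i, hi, hmin⟩ := WellFounded.has_min (wellFounded_lt (α := Fin k)) {i | n ≤ β i} h
    rw [Finset.sum_eq_single i, if_pos ⟨hi, fun j hj => not_le.1 fun h' => hmin j h' hj⟩]
    · intro j _ hji
      refine if_neg fun ⟨hj, hj'⟩ => ?_
      rcases lt_or_gt_of_ne hji with h' | h'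
      · exact hmin j hj h'
      · exact absurd (hj' i h') (not_lt.2 hi)
    · simp

end MvPowerSeries

/-! ### Multiplication of the separating ideal by power series -/

section PowerSeries

open MvPowerSeries

variable {k : ℕ} {A : Subalgebra ℂ (MvPowerSeries (Fin k) ℂ)}
  (hX : ∀ i : Fin k, (X i : MvPowerSeries (Fin k) ℂ) ∈ A)

/-- Polynomials as elements of a subalgebra of power series that contains the indeterminates. -/
noncomputable def polyMap : MvPolynomial (Fin k) ℂ →ₐ[ℂ] A :=
  MvPolynomial.aeval fun i => (⟨X i, hX i⟩ : A)

theorem coe_polyMap (P : MvPolynomial (Fin k) ℂ) :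
    (polyMap hX P : MvPowerSeries (Fin k) ℂ) = P := by
  have : A.val.comp (polyMap hX) = MvPolynomial.coeToMvPowerSeries.algHom ℂ := by
    refine MvPolynomial.algHom_ext fun i => ?_
    simp [polyMap]
  have h := congrArg (fun φ => φ P) this
  simpa using h

theorem coeff_eq_zero_of_mem_powIdeal {S : Ideal A} {n : ℕ} {a : A}
    (ha : a ∈ powIdeal (fun i => (⟨X i, hX i⟩ : A)) S n) {β : Fin k →₀ ℕ} (hβ : ∀ i, β i < n) :
    coeff β (a : MvPowerSeries (Fin k) ℂ) = 0 := by
  obtain ⟨s, -, rfl⟩ := ha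
  push_cast
  rw [map_sum]
  exact Finset.sum_eq_zero fun i _ => coeff_X_pow_mul_eq_zero (hβ i) _

theorem polyMap_mul_mem_powIdeal {S : Ideal A} {n : ℕ} {P : MvPolynomial (Fin k) ℂ}
    (hP : ∀ β ∈ P.support, ∃ i, n ≤ β i) {s : A} (hs : s ∈ S) :
    polyMap hX P * s ∈ powIdeal (fun i => (⟨X i, hX i⟩ : A)) S n := by
  rw [P.as_sum, map_sum, Finset.sum_mul]
  refine Ideal.sum_mem _ fun β hβ => ?_
  obtain ⟨i, hi⟩ := hP β hβ
  have hβ' : Finsupp.single i n + (β - Finsupp.single i n) = β :=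
    add_tsub_cancel_of_le (Finsupp.single_le_iff.2 hi)
  have : MvPolynomial.monomial β (P.coeff β) =
      MvPolynomial.X i ^ n * MvPolynomial.monomial (β - Finsupp.single i n) (P.coeff β) := by
    rw [MvPolynomial.X_pow_eq_monomial, MvPolynomial.monomial_mul, one_mul, hβ']
  rw [this, map_mul, map_pow, mul_assoc]
  have hXi : polyMap hX (MvPolynomial.X i) = ⟨X i, hX i⟩ := by simp [polyMap]
  rw [hXi]
  exact pow_mul_mem_powIdeal (fun i => (⟨X i, hX i⟩ : A)) n i (S.mul_mem_left _ hs)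

theorem coeff_trunc'_boxExp {n : ℕ} {β : Fin k →₀ ℕ} (hβ : ∀ i, β i ≤ n)
    (F : MvPowerSeries (Fin k) ℂ) :
    coeff β ((trunc' ℂ (boxExp k n) F : MvPolynomial (Fin k) ℂ) : MvPowerSeries (Fin k) ℂ) =
      coeff β F := by
  classical
  rw [MvPolynomial.coeff_coe, coeff_trunc', if_pos (show β ≤ boxExp k n from fun i => hβ i)]

/-- A Mittag-Leffler argument: the separating ideal is stable under multiplication by arbitrary
power series, although these need not belong to `A`. -/
theorem exists_mem_separatingIdeal_eq_mul
    (hX : ∀ i : Fin k, (X i : MvPowerSeries (Fin k) ℂ) ∈ A) {p q : ℕ → Seminorm ℂ A}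
    (hp : IsFrechetAlgebraSeminorms p) (hq : IsFrechetAlgebraSeminorms q)
    (hcoeff : ∀ β, ∃ m, ∃ C : ℝ, ∀ a : A, ‖coeff β (a : MvPowerSeries (Fin k) ℂ)‖ ≤ C * q m a)
    (F : MvPowerSeries (Fin k) ℂ) {s : A} (hs : s ∈ separatingIdeal hp hq) :
    ∃ t ∈ separatingIdeal hp hq, (t : MvPowerSeries (Fin k) ℂ) = F * s := by
  classical
  set S := separatingIdeal hp hq
  let W := powIdeal (fun i => (⟨X i, hX i⟩ : A)) S
  choose N₀ hN₀ using separatingIdeal_powIdeal_dense hp hq (fun i => (⟨X i, hX i⟩ : A))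
  -- An increasing sequence that dominates `N₀` and tends to infinity.
  let N : ℕ → ℕ := fun m => m + ∑ l ∈ Finset.range (m + 1), N₀ l
  have hNm : ∀ m, m ≤ N m := fun m => Nat.le_add_right _ _
  have hNsucc : ∀ m, N m ≤ N (m + 1) := fun m => by
    simp only [N, Finset.sum_range_succ _ (m + 1)]
    omega
  have hN : ∀ m, N₀ m ≤ N m := fun m => by
    simp only [N, Finset.sum_range_succ]
    omega
  let P : ℕ → A := fun m => polyMap hX (trunc' ℂ (boxExp k (N m)) F)
  have hPW : ∀ m, (P (m + 1) - P m) * s ∈ W (N m) := by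
    intro m
    rw [← map_sub]
    refine polyMap_mul_mem_powIdeal hX (fun β hβ => ?_) hs
    by_contra! hlt
    refine MvPolynomial.mem_support_iff.1 hβ ?_
    rw [MvPolynomial.coeff_sub, coeff_trunc', coeff_trunc',
      
      if_pos (show β ≤ boxExp k (N (m + 1)) from fun i => (hlt i).le.trans (hNsucc m)),
      if_pos (show β ≤ boxExp k (N m) from fun i => (hlt i).le), sub_self]
  -- The correction `t` of the `m`-th approximation `P m * s` is replaced by one in `W (N (m + 1))`.
  have hstep : ∀ m, ∀ t ∈ W (N m), ∃ t' ∈ W (N (m + 1)),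
      q m ((P (m + 1) * s + t') - (P m * s + t)) ≤ (1 / 2) ^ m := by
    intro m t ht
    obtain ⟨b, hb, hb'⟩ := hN₀ m (N m) (hN m) _ ((W (N m)).sub_mem ht (hPW m)) (N (m + 1))
      (hNsucc m) ((1 / 2) ^ m) (by positivity)
    refine ⟨b, hb, ?_⟩
    rw [map_sub_rev] at hb'
    rw [show P (m + 1) * s + b - (P m * s + t) = b - (t - (P (m + 1) - P m) * s) by ring]
    exact hb'.le
  choose! next hnext₁ hnext₂ using hstep
  let t : ℕ → A := fun m => Nat.rec 0 (fun m t => next m t) m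
  have ht : ∀ m, t m ∈ W (N m) := by
    intro m
    induction m with
    | zero => exact Ideal.zero_mem _
    | succ m ih => exact hnext₁ m _ ih
  obtain ⟨z, hz⟩ := hq.complete_of_geometric (u := fun m => P m * s + t m)
    (fun m => hnext₂ m _ (ht m))
  refine ⟨z, separatingIdeal_isClosed hp hq fun m ε hε => ?_, ?_⟩
  · obtain ⟨n, hn⟩ := ((hz m).eventually_lt_const hε).exists
    exact ⟨_, S.add_mem (S.mul_mem_left _ hs) (powIdeal_le _ _ _ (ht n)), by rwa [map_sub_rev]⟩
  · ext β
    obtain ⟨m, C, hC⟩ := hcoeff β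
    obtain ⟨B, hB⟩ := Finite.exists_le β
    have hev : ∀ᶠ n in atTop, coeff β ((P n * s + t n : A) : MvPowerSeries (Fin k) ℂ) =
        coeff β (F * (s : MvPowerSeries (Fin k) ℂ)) := by
      filter_upwards [eventually_gt_atTop B] with n hn
      have hβ : ∀ i, β i < N n := fun i => (hB i).trans_lt (hn.trans_le (hNm n))
      push_cast
      rw [map_add, coeff_eq_zero_of_mem_powIdeal hX (ht n) hβ, add_zero, coe_polyMap,
        ← sub_eq_zero, ← map_sub, ← sub_mul]
      refine coeff_mul_eq_zero (fun γ hγ => ?_) _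
      rw [map_sub, coeff_trunc'_boxExp (fun i => (hγ i).trans (hβ i).le), sub_self]
    have hlim : Tendsto (fun n => C * q m (P n * s + t n - z)) atTop (𝓝 (C * 0)) :=
      (hz m).const_mul C
    rw [mul_zero] at hlim
    rw [← sub_eq_zero, ← norm_eq_zero]
    refine le_antisymm (ge_of_tendsto hlim ?_) (norm_nonneg _)
    filter_upwards [hev] with n hn
    rw [← hn, norm_sub_rev, ← map_sub]
    simpa using hC (P n * s + t n - z)

end PowerSeries

/-! ### Functionals vanishing on ranges of finite codimension -/

section Constructions

variable {E F : Type*} [AddCommGroup E] [Module ℂ E] [AddCommGroup F] [Module ℂ F]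

/-- A closed subspace of a Fréchet space is a Fréchet space. -/
theorem IsFrechetSeminorms.restrict {p : ℕ → Seminorm ℂ E} (hp : IsFrechetSeminorms p)
    {V : Submodule ℂ E}
    (hV : ∀ x, (∀ m, ∀ ε : ℝ, 0 < ε → ∃ y ∈ V, p m (x - y) < ε) → x ∈ V) :
    IsFrechetSeminorms fun m => (p m).comp V.subtype where
  mono := fun _ _ h x => hp.mono h x
  eq_zero := fun x hx => Subtype.ext (hp.eq_zero x hx)
  complete := by
    intro u hu
    obtain ⟨x, hx⟩ := hp.complete (fun n => (u n : E)) hu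
    refine ⟨⟨x, hV x fun m ε hε => ?_⟩, hx⟩
    obtain ⟨n, hn⟩ := ((hx m).eventually_lt_const hε).exists
    exact ⟨u n, (u n).2, by rwa [map_sub_rev]⟩

theorem isFrechetSeminorms_norm (V : Type*) [NormedAddCommGroup V] [NormedSpace ℂ V]
    [CompleteSpace V] : IsFrechetSeminorms fun _ : ℕ => normSeminorm ℂ V where
  mono := fun _ _ _ => le_rfl
  eq_zero := fun x hx => norm_eq_zero.1 (hx 0)
  complete := by
    intro u hu
    obtain ⟨x, hx⟩ := cauchySeq_tendsto_of_complete (u := u) <| Metric.cauchySeq_iff.2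
      fun ε hε => by simpa [dist_eq_norm] using hu 0 ε hε
    exact ⟨x, fun _ => tendsto_iff_norm_sub_tendsto_zero.1 hx⟩

theorem IsFrechetSeminorms.prod {p : ℕ → Seminorm ℂ E} (hp : IsFrechetSeminorms p)
    {q : ℕ → Seminorm ℂ F} (hq : IsFrechetSeminorms q) :
    IsFrechetSeminorms fun m =>
      (p m).comp (LinearMap.fst ℂ E F) + (q m).comp (LinearMap.snd ℂ E F) where
  mono := fun _ _ h x => add_le_add (hp.mono h x.1) (hq.mono h x.2)
  eq_zero := by
    intro x hx
    have h : ∀ m, p m x.1 + q m x.2 = 0 := hx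
    refine Prod.ext (hp.eq_zero _ fun m => ?_) (hq.eq_zero _ fun m => ?_) <;>
    linarith [h m, apply_nonneg (p m) x.1, apply_nonneg (q m) x.2]
  complete := by
    intro u hu
    obtain ⟨x, hx⟩ := hp.complete (fun n => (u n).1) fun m ε hε => by
      obtain ⟨N, hN⟩ := hu m ε hε
      exact ⟨N, fun i hi j hj =>
        (le_add_of_nonneg_right (apply_nonneg (q m) _)).trans_lt (hN i hi j hj)⟩
    obtain ⟨y, hy⟩ := hq.complete (fun n => (u n).2) fun m ε hε => by
      obtain ⟨N, hN⟩ := hu m ε hε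
      exact ⟨N, fun i hi j hj =>
        (le_add_of_nonneg_left (apply_nonneg (p m) _)).trans_lt (hN i hi j hj)⟩
    exact ⟨(x, y), fun m => by simpa using (hx m).add (hy m)⟩

theorem IsFrechetSeminorms.pi {p : ℕ → Seminorm ℂ E} (hp : IsFrechetSeminorms p) (ι : Type*)
    [Fintype ι] :
    IsFrechetSeminorms fun m =>
      ∑ i : ι, (p m).comp (LinearMap.proj i : (ι → E) →ₗ[ℂ] E) where
  mono := fun _ _ h x => by
    simp only [sum_apply]
    exact Finset.sum_le_sum fun i _ => hp.mono h (x i)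
  eq_zero := by
    intro x hx
    refine funext fun i => hp.eq_zero _ fun m => ?_
    have h := hx m
    rw [sum_apply, Finset.sum_eq_zero_iff_of_nonneg (fun _ _ => apply_nonneg _ _)] at h
    exact h i (Finset.mem_univ i)
  complete := by
    intro u hu
    choose x hx using fun i => hp.complete (fun n => u n i) fun m ε hε => by
      obtain ⟨N, hN⟩ := hu m ε hε
      refine ⟨N, fun a ha b hb => lt_of_le_of_lt ?_ (hN a ha b hb)⟩
      rw [sum_apply]
      exact Finset.single_le_sum
        (f := fun i => (p m).comp (LinearMap.proj i : (ι → E) →ₗ[ℂ] E) (u a - u b))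
        (fun _ _ => apply_nonneg _ _) (Finset.mem_univ i)
    refine ⟨x, fun m => ?_⟩
    have := tendsto_finsetSum (Finset.univ : Finset ι) fun i _ => hx i m
    simpa [sum_apply] using this

end Constructions

/-- If the ranges of finitely many continuous operators on a Fréchet space together have finite
codimension, then every linear functional that vanishes on these ranges is continuous. -/
theorem IsFrechetSeminorms.exists_bound_of_finite_codim {E ι κ : Type*} [AddCommGroup E]
    [Module ℂ E] [Fintype ι] [Fintype κ] {p : ℕ → Seminorm ℂ E} (hp : IsFrechetSeminorms p)
    (T : ι → E →ₗ[ℂ] E) {C : ι → ℕ → ℝ} (hC : ∀ i m, 0 ≤ C i m)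
    (hT : ∀ i m x, p m (T i x) ≤ C i m * p m x)
    (w : κ → E) (hw : ∀ x, ∃ (g : ι → E) (v : κ → ℂ), ∑ i, T i (g i) + ∑ j, v j • w j = x)
    (ψ : E →ₗ[ℂ] ℂ) (hψ : ∀ i x, ψ (T i x) = 0) :
    ∃ m, ∃ D : ℝ, 0 ≤ D ∧ ∀ x, ‖ψ x‖ ≤ D * p m x := by
  -- `Θ (g, v) = ∑ i, T i (g i) + ∑ j, v j • w j` is a continuous surjection, hence open, and
  -- `ψ ∘ Θ` is continuous because it depends on `v` only.
  let Θ : (ι → E) × (κ → ℂ) →ₗ[ℂ] E :=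
    ((∑ i, (T i).comp (LinearMap.proj i)).comp (LinearMap.fst ℂ _ _)) +
      (Fintype.linearCombination ℂ w).comp (LinearMap.snd ℂ _ _)
  have hΘ : ∀ g, Θ g = ∑ i, T i (g.1 i) + ∑ j, g.2 j • w j := fun g => by
    simp [Θ, Fintype.linearCombination_apply]
  have hΘs : Function.Surjective Θ := fun x => by
    obtain ⟨g, v, h⟩ := hw x
    exact ⟨(g, v), by rw [hΘ, h]⟩
  have hG := (hp.pi ι).prod (isFrechetSeminorms_norm (κ → ℂ))
  set Q : ℕ → Seminorm ℂ ((ι → E) × (κ → ℂ)) := fun m =>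
    (∑ i : ι, (p m).comp (LinearMap.proj i : (ι → E) →ₗ[ℂ] E)).comp (LinearMap.fst ℂ _ _) +
      (normSeminorm ℂ (κ → ℂ)).comp (LinearMap.snd ℂ _ _)
  have hQ : ∀ m g, Q m g = ∑ i, p m (g.1 i) + ‖g.2‖ := fun m g => by
    simp [Q]
  have hΘbound : ∀ m g, p m (Θ g) ≤ (∑ i, C i m + ∑ j, p m (w j)) * Q m g := by
    intro m g
    have hQ₁ : ∀ i, p m (g.1 i) ≤ Q m g := fun i => by
      rw [hQ]
      have := Finset.single_le_sum (f := fun i => p m (g.1 i)) (fun _ _ => apply_nonneg _ _)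
        (Finset.mem_univ i)
      have := norm_nonneg g.2
      linarith
    have hQ₂ : ‖g.2‖ ≤ Q m g := by
      rw [hQ]
      have : 0 ≤ ∑ i, p m (g.1 i) := Finset.sum_nonneg fun _ _ => apply_nonneg _ _
      linarith
    rw [hΘ, add_mul, Finset.sum_mul, Finset.sum_mul]
    refine (map_add_le_add _ _ _).trans (add_le_add ?_ ?_)
    · refine (Finset.le_sum_of_subadditive _ (map_zero _).le (fun x y => map_add_le_add _ x y)
        _ _).trans (Finset.sum_le_sum fun i _ => (hT i m _).trans ?_)
      exact mul_le_mul_of_nonneg_left (hQ₁ i) (hC i m)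
    · refine (Finset.le_sum_of_subadditive _ (map_zero _).le (fun x y => map_add_le_add _ x y)
        _ _).trans (Finset.sum_le_sum fun j _ => ?_)
      rw [map_smul_eq_mul, mul_comm]
      exact mul_le_mul_of_nonneg_left ((norm_le_pi_norm g.2 j).trans hQ₂) (apply_nonneg _ _)
  have hψΘ : ∀ g, ψ (Θ g) = ∑ j, g.2 j * ψ (w j) := fun g => by
    simp [hΘ, hψ]
  obtain ⟨m, D, hD, h⟩ := hp.exists_bound hG hΘs (r := (normSeminorm ℂ ℂ).comp (ψ.comp Θ))
    (C := ∑ j, ‖ψ (w j)‖) (k := 0) (fun g => by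
      change ‖ψ (Θ g)‖ ≤ _ * Q 0 g
      rw [hψΘ, Finset.sum_mul]
      refine (norm_sum_le _ _).trans (Finset.sum_le_sum fun j _ => ?_)
      rw [norm_mul, mul_comm]
      refine mul_le_mul_of_nonneg_left ((norm_le_pi_norm g.2 j).trans ?_) (norm_nonneg _)
      rw [hQ]
      exact le_add_of_nonneg_left (Finset.sum_nonneg fun _ _ => apply_nonneg _ _))
    (fun g hg => by
      have : Θ g = 0 := by
        refine hp.eq_zero _ fun m => le_antisymm (le_of_forall_pos_le_add fun ε hε => ?_)
          (apply_nonneg _ _)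
        have hK : 0 ≤ ∑ i, C i m + ∑ j, p m (w j) :=
          add_nonneg (Finset.sum_nonneg fun i _ => hC i m)
            (Finset.sum_nonneg fun _ _ => apply_nonneg _ _)
        have hδ : 0 < ε / (1 + (∑ i, C i m + ∑ j, p m (w j))) := by positivity
        have hδ' : (1 + (∑ i, C i m + ∑ j, p m (w j))) *
          (ε / (1 + (∑ i, C i m + ∑ j, p m (w j)))) = ε := by field_simp
        obtain ⟨u, hu₁, hu₂⟩ := hg m _ hδ
        have h1 := map_add_le_add (p m) (Θ (g - u)) (Θ u)
        rw [← map_add, sub_add_cancel] at h1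
        have h2 := hΘbound m (g - u)
        have h3 := mul_le_mul_of_nonneg_left hu₂.le hK
        linarith
      change ‖ψ (Θ g)‖ = 0
      rw [this, map_zero, norm_zero])
  refine ⟨m, D, hD, fun x => ?_⟩
  obtain ⟨g, rfl⟩ := hΘs x
  exact h g

/-! ### The separating ideal vanishes -/

section Uniqueness

open MvPowerSeries

variable {k : ℕ} {A : Subalgebra ℂ (MvPowerSeries (Fin k) ℂ)}

/-- The coefficient functionals are continuous for `p` on the separating ideal `S`. Indeed `S` is a
finitely generated ideal of the ring of power series, so `∑ i, X i ^ n * S` has finite codimension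
in `S`, and the coefficients of exponents with entries `< n` vanish on it. -/
theorem exists_bound_coeff_of_mem_separatingIdeal
    (hX : ∀ i : Fin k, (X i : MvPowerSeries (Fin k) ℂ) ∈ A) {p q : ℕ → Seminorm ℂ A}
    (hp : IsFrechetAlgebraSeminorms p) (hq : IsFrechetAlgebraSeminorms q)
    (hcoeff : ∀ β, ∃ m, ∃ C : ℝ, ∀ a : A, ‖coeff β (a : MvPowerSeries (Fin k) ℂ)‖ ≤ C * q m a)
    (β : Fin k →₀ ℕ) :
    ∃ m, ∃ D : ℝ, 0 ≤ D ∧ ∀ s ∈ separatingIdeal hp hq,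
      ‖coeff β (s : MvPowerSeries (Fin k) ℂ)‖ ≤ D * p m s := by
  classical
  let S := separatingIdeal hp hq
  -- The separating ideal as an ideal of the ring of all power series.
  let SF : Ideal (MvPowerSeries (Fin k) ℂ) :=
    { carrier := {F | ∃ s ∈ S, (s : MvPowerSeries (Fin k) ℂ) = F}
      zero_mem' := ⟨0, S.zero_mem, rfl⟩
      add_mem' := by
        rintro _ _ ⟨s, hs, rfl⟩ ⟨t, ht, rfl⟩
        exact ⟨s + t, S.add_mem hs ht, rfl⟩
      smul_mem' := by
        rintro F _ ⟨s, hs, rfl⟩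
        exact exists_mem_separatingIdeal_eq_mul hX hp hq hcoeff F hs }
  obtain ⟨r, e, he⟩ := Submodule.fg_iff_exists_fin_generating_family.1 (IsNoetherian.noetherian SF)
  have heSF : ∀ j, e j ∈ SF := fun j => he ▸ Submodule.subset_span ⟨j, rfl⟩
  choose s hs hse using heSF
  obtain ⟨B, hB⟩ := Finite.exists_le β
  let V : Submodule ℂ A := S.restrictScalars ℂ
  have hV : IsFrechetSeminorms (E := V) fun m => (p m).comp V.subtype :=
    hp.toIsFrechetSeminorms.restrict (V := V) fun x hx => by
      change x ∈ separatingIdeal hp hq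
      rw [separatingIdeal_comm]
      refine separatingIdeal_isClosed hq hp fun m ε hε => ?_
      obtain ⟨y, hy, hxy⟩ := hx m ε hε
      exact ⟨y, separatingIdeal_comm hp hq ▸ hy, hxy⟩
  let x : Fin k → A := fun i => ⟨X i, hX i⟩
  let T : Fin k → V →ₗ[ℂ] V := fun i =>
    (LinearMap.mulLeft ℂ (x i ^ (B + 1))).restrict fun a ha => S.mul_mem_left _ ha
  let w : Finset.Iic (boxExp k B) × Fin r → V := fun c =>
    ⟨polyMap hX (MvPolynomial.monomial c.1 1) * s c.2, S.mul_mem_left _ (hs c.2)⟩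
  let ψ : V →ₗ[ℂ] ℂ := (coeff β).comp (A.val.toLinearMap.comp V.subtype)
  -- Modulo `∑ i, X i ^ (B + 1) * S`, the elements of `S` are combinations of the generators of `S`
  -- whose coefficients are polynomials with exponents in a box.
  have hspan : ∀ a : V, ∃ (g : Fin k → V) (v : Finset.Iic (boxExp k B) × Fin r → ℂ),
      ∑ i, T i (g i) + ∑ c, v c • w c = a := by
    intro a
    have haSF : (a : MvPowerSeries (Fin k) ℂ) ∈ SF := ⟨a, a.2, rfl⟩
    rw [← he, Submodule.mem_span_range_iff_exists_fun] at haSF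
    obtain ⟨F, hF⟩ := haSF
    have hdecomp : ∀ j, ∃ g : Fin k → MvPowerSeries (Fin k) ℂ, F j -
        ((trunc' ℂ (boxExp k B) (F j) : MvPolynomial (Fin k) ℂ) : MvPowerSeries (Fin k) ℂ) =
          ∑ i, X i ^ (B + 1) * g i := fun j => by
      refine exists_eq_sum_X_pow_mul (B + 1) _ fun γ hγ => ?_
      rw [map_sub, coeff_trunc'_boxExp (fun i => Nat.le_of_lt_succ (hγ i)), sub_self]
    choose g hg using hdecomp
    have hy : ∀ i, ∑ j, g j i * e j ∈ SF := fun i =>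
      SF.sum_mem fun j _ => SF.mul_mem_left _ ⟨s j, hs j, hse j⟩
    choose y hyS hy using hy
    refine ⟨fun i => ⟨y i, hyS i⟩, fun c => coeff c.1 (F c.2), ?_⟩
    apply Subtype.ext
    apply Subtype.ext
    have hT : ∀ i, (((T i ⟨y i, hyS i⟩ : V) : A) : MvPowerSeries (Fin k) ℂ) =
        X i ^ (B + 1) * ∑ j, g j i * e j := fun i => by
      rw [← hy i]; rfl
    have hw : ∀ c, (((w c : V) : A) : MvPowerSeries (Fin k) ℂ) = monomial c.1 1 * e c.2 :=
      fun c => by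
        simp [w, coe_polyMap, hse]
    push_cast
    simp only [hT, hw]
    rw [← hF, Fintype.sum_prod_type_right]
    have htr : ∀ j, ∑ γ : Finset.Iic (boxExp k B),
        coeff (γ : Fin k →₀ ℕ) (F j) • (monomial (γ : Fin k →₀ ℕ) (1 : ℂ) * e j) =
          ((trunc' ℂ (boxExp k B) (F j) : MvPolynomial (Fin k) ℂ) : MvPowerSeries (Fin k) ℂ) *
            e j := by
      intro j
      rw [Finset.sum_coe_sort (Finset.Iic (boxExp k B)) fun γ =>
        coeff γ (F j) • (monomial γ (1 : ℂ) * e j)]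
      have htr' : ((trunc' ℂ (boxExp k B) (F j) : MvPolynomial (Fin k) ℂ) :
          MvPowerSeries (Fin k) ℂ) =
          ∑ γ ∈ Finset.Iic (boxExp k B), coeff γ (F j) • monomial γ (1 : ℂ) := by
        rw [trunc', truncFinset_apply, ← MvPolynomial.coeToMvPowerSeries.ringHom_apply, map_sum]
        refine Finset.sum_congr rfl fun γ _ => ?_
        simp [← map_smul]
      rw [htr', Finset.sum_mul]
      exact Finset.sum_congr rfl fun γ _ => (smul_mul_assoc _ _ _).symm
    simp only [htr, Finset.mul_sum, smul_eq_mul]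
    rw [Finset.sum_comm, ← Finset.sum_add_distrib]
    refine Finset.sum_congr rfl fun j _ => ?_
    simp only [← mul_assoc]
    rw [← Finset.sum_mul, ← hg j]
    ring
  obtain ⟨m, D, hD, h⟩ := hV.exists_bound_of_finite_codim T
    (C := fun i m => p m (x i ^ (B + 1))) (fun i m => apply_nonneg _ _)
    (fun i m a => hp.mul_le m _ _) w hspan ψ
    (fun i a => coeff_X_pow_mul_eq_zero (Nat.lt_succ_of_le (hB i)) _)
  exact ⟨m, D, hD, fun a ha => h ⟨a, ha⟩⟩

/-- The separating ideal of a Fréchet algebra structure on `A` and one for which the coefficient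
functionals are continuous vanishes. -/
theorem separatingIdeal_eq_bot
    (hX : ∀ i : Fin k, (X i : MvPowerSeries (Fin k) ℂ) ∈ A) {p q : ℕ → Seminorm ℂ A}
    (hp : IsFrechetAlgebraSeminorms p) (hq : IsFrechetAlgebraSeminorms q)
    (hcoeff : ∀ β, ∃ m, ∃ C : ℝ, ∀ a : A, ‖coeff β (a : MvPowerSeries (Fin k) ℂ)‖ ≤ C * q m a) :
    separatingIdeal hp hq = ⊥ := by
  refine (Submodule.eq_bot_iff _).2 fun s hs => ?_
  have hsq : ((s : MvPowerSeries (Fin k) ℂ) * s) = 0 := by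
    ext β
    obtain ⟨m, C, hC⟩ := hcoeff β
    obtain ⟨l, D, hD, h⟩ := exists_bound_coeff_of_mem_separatingIdeal hX hp hq hcoeff β
    rw [map_zero, ← norm_eq_zero]
    refine le_antisymm (le_of_forall_pos_le_add fun ε hε => ?_) (norm_nonneg _)
    have hps := apply_nonneg (p l) s
    have hqs := apply_nonneg (q m) s
    have hK : 0 < 1 + D * p l s + |C| * q m s := by positivity
    have hK' : (1 + D * p l s + |C| * q m s) * (ε / (1 + D * p l s + |C| * q m s)) = ε := by
      field_simp
    obtain ⟨u, hu₁, hu₂⟩ := hs (max l m) _ (div_pos hε hK)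
    have hpos := div_pos hε hK
    set δ := ε / (1 + D * p l s + |C| * q m s)
    have h1 : ‖coeff β ((u * s : A) : MvPowerSeries (Fin k) ℂ)‖ ≤ D * (δ * p l s) :=
      (h _ (Ideal.mul_mem_left _ u hs)).trans <| mul_le_mul_of_nonneg_left
        ((hp.mul_le l u s).trans (mul_le_mul_of_nonneg_right
          ((hp.mono (le_max_left l m) u).trans hu₁.le) hps)) hD
    have h2 : ‖coeff β (((s - u) * s : A) : MvPowerSeries (Fin k) ℂ)‖ ≤ |C| * (δ * q m s) :=
      (hC _).trans <| (mul_le_mul_of_nonneg_right (le_abs_self C) (apply_nonneg _ _)).trans <|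
        mul_le_mul_of_nonneg_left ((hq.mul_le m _ s).trans (mul_le_mul_of_nonneg_right
          ((hq.mono (le_max_right l m) _).trans hu₂.le) hqs)) (abs_nonneg C)
    have h3 : (s : MvPowerSeries (Fin k) ℂ) * s =
        ((u * s : A) : MvPowerSeries (Fin k) ℂ) + (((s - u) * s : A) : MvPowerSeries (Fin k) ℂ) := by
      push_cast
      ring
    rw [h3, map_add]
    refine (norm_add_le _ _).trans ?_
    linarith
  exact Subtype.ext (mul_self_eq_zero.1 hsq)

end Uniqueness

/-! ### From seminorms to topologies -/

section Topology

theorem IsFrechetAlgebraTopology.exists_isFrechetAlgebraSeminorms {A : Type*} [CommRing A]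
    [Algebra ℂ A] {τ : TopologicalSpace A} (h : IsFrechetAlgebraTopology A τ) :
    ∃ p : ℕ → Seminorm ℂ A, IsFrechetAlgebraSeminorms p ∧ WithSeminorms p := by
  obtain ⟨hgrp, hmetr, hcomp, p, hmono, hmul, hp⟩ := h
  refine ⟨p, ⟨⟨hmono, fun x hx => ?_, fun u hu => ?_⟩, hmul⟩, hp⟩
  · by_contra hne
    obtain ⟨m, hm⟩ := hp.separating_of_T1 x hne
    exact hm (hx m)
  · let : UniformSpace A := IsTopologicalAddGroup.rightUniformSpace A
    have : IsUniformAddGroup A := isUniformAddGroup_of_addCommGroup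
    obtain ⟨x, hx⟩ := cauchySeq_tendsto_of_complete ((cauchySeq_iff_seminorms hp u).2 hu)
    exact ⟨x, (tendsto_iff_seminorms hp u x).1 hx⟩

/-- The closed graph theorem for the identity map: if the separating ideal vanishes, then the
topology of `p` is finer than that of `q`. -/
theorem le_of_separatingIdeal_eq_bot {A : Type*} [CommRing A] [Algebra ℂ A]
    {p q : ℕ → Seminorm ℂ A} (hp : IsFrechetAlgebraSeminorms p) (hq : IsFrechetAlgebraSeminorms q)
    (h : separatingIdeal hp hq = ⊥) {σ τ : TopologicalSpace A} (hσ : WithSeminorms (topology := σ) p)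
    (hτ : WithSeminorms (topology := τ) q) : σ ≤ τ := by
  refine continuous_id_iff_le.1 (WithSeminorms.continuous_of_isBounded hσ hτ LinearMap.id
    fun i => ?_)
  obtain ⟨m, D, hD, hb⟩ := hp.exists_bound hq.toIsFrechetSeminorms (Θ := LinearMap.id)
    Function.surjective_id (r := q i) (C := 1) (k := i) (fun g => (one_mul _).ge) (fun g hg => by
      have hg' : g ∈ separatingIdeal hp hq := hg
      rw [h, Ideal.mem_bot] at hg'
      rw [hg', map_zero])
  exact ⟨{m}, ⟨D, hD⟩, fun g => by rw [Finset.sup_singleton]; exact hb g⟩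

open scoped MvPowerSeries.WithPiTopology in
theorem IsFrechetAlgebraOfPowerSeries.exists_bound_coeff {k : ℕ}
    {A : Subalgebra ℂ (MvPowerSeries (Fin k) ℂ)} {τ : TopologicalSpace A}
    (hA : IsFrechetAlgebraOfPowerSeries A τ) {q : ℕ → Seminorm ℂ A} (hmono : Monotone q)
    (hq : WithSeminorms q) (β : Fin k →₀ ℕ) :
    ∃ m, ∃ C : ℝ, ∀ a : A,
      ‖MvPowerSeries.coeff β (a : MvPowerSeries (Fin k) ℂ)‖ ≤ C * q m a := by
  let φ : A →ₗ[ℂ] ℂ := (MvPowerSeries.coeff β).comp A.val.toLinearMap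
  have hφ : Continuous φ :=
    (MvPowerSeries.WithPiTopology.continuous_coeff ℂ β).comp hA.continuous_inclusion
  obtain ⟨t, C, -, h⟩ := Seminorm.bound_of_continuous hq ((normSeminorm ℂ ℂ).comp φ) hφ.norm
  refine ⟨t.sup id, C, fun a => (h a).trans ?_⟩
  have hle : t.sup q ≤ q (t.sup id) :=
    Finset.sup_le fun i hi => hmono (Finset.le_sup (f := id) hi)
  exact mul_le_mul_of_nonneg_left (hle a) C.2

end Topology

theorem corollary4p3 (k : ℕ) (hk : 1 ≤ k) (A : Subalgebra ℂ (MvPowerSeries (Fin k) ℂ))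
    (τ : TopologicalSpace A) (hA : IsFrechetAlgebraOfPowerSeries A τ) :
    ∃! σ : TopologicalSpace A, IsFrechetAlgebraTopology A σ := by
  refine ⟨τ, hA.isFrechet, fun σ hσ => ?_⟩
  obtain ⟨p, hp, hpσ⟩ := hσ.exists_isFrechetAlgebraSeminorms
  obtain ⟨q, hq, hqτ⟩ := hA.isFrechet.exists_isFrechetAlgebraSeminorms
  have hcoeff := hA.exists_bound_coeff hq.mono hqτ
  have hbot := separatingIdeal_eq_bot hA.X_mem hp hq hcoeff
  exact le_antisymm (le_of_separatingIdeal_eq_bot hp hq hbot hpσ hqτ)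
    (le_of_separatingIdeal_eq_bot hq hp (separatingIdeal_comm hp hq ▸ hbot) hqτ hpσ)
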